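/- Let $\Bbbk$ be a field of characteristic $2$, let $G=\langle\sigma,\tau\rangle$ be the Klein four-group, and let $\chi=\{\langle\sigma\rangle,\langle\tau\rangle,\langle\sigma\tau\rangle\}$ be the set of its proper nontrivial subgroups. A $\Bbbk G$-module $M$ is *projective relative to $\chi$* if every $\Bbbk G$-homomorphism $M\to Y$ lifts along every surjective $\Bbbk G$-homomorphism $X\to Y$ that splits on restriction to each $H\in\chi$. A *relatively projective resolution* of $\Bbbk$ is an exact sequence $\cdots\to Q_1\to Q_0\to\Bbbk\to 0$ of $\Bbbk G$-modules in which every $Q_i$ is projective relative to $\chi$ and every map splits on restriction to each $H\in\chi$. (A homomorphism $f\colon A\to B$ splits on restriction to $H$ if $fsf=f$ for some $\Bbbk H$-homomorphism $s\colon B\to A$.) For a $\Bbbk G$-module $N$, $H^i_\chi(G,N)$ is the $i$-th cohomology of the complex $0\to\operatorname{Hom}_{\Bbbk G}(Q_0,N)\to\operatorname{Hom}_{\Bbbk G}(Q_1,N)\to\cdots$, computed from any such resolution. Put $X=\sigma-1$ and $Y=\tau-1$. For $n\ge 1$, let $V_{2n,\infty}$ be the $\Bbbk G$-module with basis $a_1,\dots,a_n,b_1,\dots,b_n$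 and $Xb_i=Yb_i=0$, $Xa_i=b_i$ for all $i$, $Ya_i=b_{i+1}$ for $i<n$, $Ya_n=0$. For a polynomial $\theta(x)=x^n+\lambda_1x^{n-1}+\dots+\lambda_n\in\Bbbk[x]$ that is a power of a monic irreducible polynomial, let $V_{2n,\theta}$ be the $\Bbbk G$-module with basis $a_1,\dots,a_n,b_1,\dots,b_n$ and $Xb_i=Yb_i=0$, $Ya_i=b_i$ for all $i$, $Xa_i=b_{i-1}$ for $i>1$, $Xa_1=\sum_{i=1}^n\lambda_ib_i$. **Proposition.** Let $N$ be an even-dimensional (in particular finite-dimensional) indecomposable $\Bbbk G$-module that is not projective relative to $\chi$. 1. If, for some $n\ge1$, $N\cong V_{2n,\infty}$ or $N\cong V_{2n,\theta}$ with $\theta(x)=x^n$ or $\theta(x)=(x+1)^n$, then $\dim_\Bbbk H^0_\chi(G,N)=n$ and $\dim_\Bbbk H^i_\chi(G,N)=n-1$ for all $i>0$. 2. If $N\cong V_{2n,\theta}$, where $n\ge1$ and $\theta$ is a power of a monic irreducible polynomial, has degree $n$, and is neither $x^n$ nor $(x+1)^n$, then $\dim_\Bbbk H^i_\chi(G,N)=n$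 for all $i\ge0$. -/

import Mathlib

open CategoryTheory

universe u

namespace RelCoh

noncomputable section

section General

variable {k G : Type u} [Field k] [Group G]

/-- The homomorphism `f` splits on restriction to the subgroup `H`: there is an `H`-equivariant
linear map `s` in the opposite direction with `f ∘ s ∘ f = f`. For surjective `f` this says
`f ∘ s = id`; in general it says that `f`, as a map onto its image, has an `H`-equivariant section
that extends to the whole target. -/
def SplitsOver (H : Subgroup G) {A B : Rep.{u} k G} (f : A ⟶ B) : Prop :=
  ∃ s : B →ₗ[k] A, (∀ h ∈ H, ∀ b, s (B.ρ h b) = A.ρ h (s b)) ∧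
    ∀ a, f.hom (s (f.hom a)) = f.hom a

/-- `M` is projective relative to the set `χ` of subgroups: homomorphisms out of `M` lift along
every surjection that splits on restriction to each member of `χ`. -/
def IsRelProjective (χ : Set (Subgroup G)) (M : Rep.{u} k G) : Prop :=
  ∀ ⦃X Y : Rep.{u} k G⦄ (j : X ⟶ Y) (φ : M ⟶ Y),
    Function.Surjective j.hom → (∀ H ∈ χ, SplitsOver H j) → ∃ ψ : M ⟶ X, ψ ≫ j = φ

/-- A resolution `… ⟶ Q 1 ⟶ Q 0 ⟶ M ⟶ 0` of `M` that is projective relative to `χ`: an exact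
sequence of relatively projective modules whose maps split on restriction to each `H ∈ χ`. -/
structure RelProjResolution (χ : Set (Subgroup G)) (M : Rep.{u} k G) where
  Q : ℕ → Rep.{u} k G
  d : ∀ i, Q (i + 1) ⟶ Q i
  ε : Q 0 ⟶ M
  relProjective : ∀ i, IsRelProjective χ (Q i)
  surjective : Function.Surjective ε.hom
  exact_zero : Function.Exact (d 0).hom ε.hom
  exact_succ : ∀ i, Function.Exact (d (i + 1)).hom (d i).hom
  splits_ε : ∀ H ∈ χ, SplitsOver H ε
  splits_d : ∀ i, ∀ H ∈ χ, SplitsOver H (d i)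

namespace RelProjResolution

variable {χ : Set (Subgroup G)} {M : Rep.{u} k G} (P : RelProjResolution χ M) (N : Rep.{u} k G)

/-- The coboundary `Hom(Q i, N) → Hom(Q (i + 1), N)`, precomposition with `d i`. -/
def δ (i : ℕ) : (P.Q i ⟶ N) →ₗ[k] (P.Q (i + 1) ⟶ N) :=
  Linear.leftComp k N (P.d i)

/-- The image of the coboundary map that arrives in degree `i` (zero for `i = 0`). -/
def coboundaries : (i : ℕ) → Submodule k (P.Q i ⟶ N)
  | 0 => ⊥
  | i + 1 => LinearMap.range (P.δ N i)

/-- The relative Ext group `Ext^i_{kG,χ}(M, N)`, computed from the resolution `P` of `M`: the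
cohomology in degree `i` of `0 → Hom(Q 0, N) → Hom(Q 1, N) → …`. -/
abbrev Ext (i : ℕ) : Type u :=
  LinearMap.ker (P.δ N i) ⧸ (P.coboundaries N i).submoduleOf (LinearMap.ker (P.δ N i))

end RelProjResolution

/-! Relatively projective resolutions exist. -/

/-- The representation `⨁_{H ∈ χ} k[G ⧸ H] ⊗ M` with diagonal action. -/
def coverRep (χ : Set (Subgroup G)) (M : Rep.{u} k G) : Rep.{u} k G :=
  Rep.of (X := (Σ H : χ, G ⧸ H.1) →₀ M)
    { toFun := fun g => Finsupp.lmapDomain M k (fun i => g • i) ∘ₗ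
        Finsupp.mapRange.linearMap (M.ρ g)
      map_one' := by
        ext i m : 2
        simp
      map_mul' := fun g h => by
        ext i m : 2
        simp [mul_smul] }

/-- The inclusion of a component. -/
def coverIn (χ : Set (Subgroup G)) (M : Rep.{u} k G) (i : Σ H : χ, G ⧸ H.1) :
    M →ₗ[k] coverRep χ M :=
  Finsupp.lsingle i

/-- The linear map with given components. -/
def coverDesc {χ : Set (Subgroup G)} {M : Rep.{u} k G} {V : Type u} [AddCommGroup V] [Module k V]
    (f : (Σ H : χ, G ⧸ H.1) → M →ₗ[k] V) : coverRep χ M →ₗ[k] V :=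
  Finsupp.lsum k f

theorem coverDesc_in {χ : Set (Subgroup G)} {M : Rep.{u} k G} {V : Type u} [AddCommGroup V]
    [Module k V] (f : (Σ H : χ, G ⧸ H.1) → M →ₗ[k] V) (i : Σ H : χ, G ⧸ H.1) (m : M) :
    coverDesc f (coverIn χ M i m) = f i m := by
  change Finsupp.lsum k f (Finsupp.single i m) = f i m
  simp

theorem coverRep_ext {χ : Set (Subgroup G)} {M : Rep.{u} k G} {V : Type u} [AddCommGroup V]
    [Module k V] {f g : coverRep χ M →ₗ[k] V}
    (h : ∀ i m, f (coverIn χ M i m) = g (coverIn χ M i m)) : f = g :=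
  Finsupp.lhom_ext h

theorem coverRep_in (χ : Set (Subgroup G)) (M : Rep.{u} k G) (g : G) (i : Σ H : χ, G ⧸ H.1)
    (m : M) : (coverRep χ M).ρ g (coverIn χ M i m) = coverIn χ M (g • i) (M.ρ g m) := by
  change Finsupp.lmapDomain M k (fun i => g • i) (Finsupp.mapRange.linearMap (M.ρ g)
    (Finsupp.single i m)) = Finsupp.single (g • i) (M.ρ g m)
  simp

/-- The projection `coverRep χ M ⟶ M` that adds up all components. -/
def coverMap (χ : Set (Subgroup G)) (M : Rep.{u} k G) : coverRep χ M ⟶ M :=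
  Rep.ofHom
    { toLinearMap := coverDesc fun _ => LinearMap.id
      isIntertwining' := fun g => coverRep_ext fun i m => by
        change coverDesc _ ((coverRep χ M).ρ g (coverIn χ M i m)) =
          M.ρ g (coverDesc _ (coverIn χ M i m))
        rw [coverRep_in, coverDesc_in, coverDesc_in]
        rfl }

theorem coverMap_in (χ : Set (Subgroup G)) (M : Rep.{u} k G) (i : Σ H : χ, G ⧸ H.1)
    (m : M) : (coverMap χ M).hom (coverIn χ M i m) = m :=
  coverDesc_in _ i m

/-- The index of the trivial coset of `H`. -/
def coverBase {χ : Set (Subgroup G)} (H : χ) : Σ H : χ, G ⧸ H.1 := ⟨H, ((1 : G) : G ⧸ H.1)⟩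

theorem smul_coverBase {χ : Set (Subgroup G)} (H : χ) {h : G} (hh : h ∈ H.1) :
    h • coverBase H = coverBase H := by
  change (⟨H, ((h * 1 : G) : G ⧸ H.1)⟩ : Σ H : χ, G ⧸ H.1) = ⟨H, ((1 : G) : G ⧸ H.1)⟩
  congr 1
  rw [QuotientGroup.eq]
  simpa using hh

theorem out_smul_coverBase {χ : Set (Subgroup G)} (i : Σ H : χ, G ⧸ H.1) :
    i.2.out • coverBase i.1 = i := by
  obtain ⟨H, x⟩ := i
  change (⟨H, ((x.out * 1 : G) : G ⧸ H.1)⟩ : Σ H : χ, G ⧸ H.1) = ⟨H, x⟩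
  congr 1
  simp

theorem out_smul_mem {χ : Set (Subgroup G)} (i : Σ H : χ, G ⧸ H.1) (g : G) :
    (g • i).2.out⁻¹ * (g * i.2.out) ∈ i.1.1 := by
  obtain ⟨H, x⟩ := i
  change (g • x).out⁻¹ * (g * x.out) ∈ H.1
  rw [← QuotientGroup.eq]
  have : ((g * x.out : G) : G ⧸ H.1) = g • ((x.out : G) : G ⧸ H.1) := rfl
  rw [this]
  simp

theorem coverMap_section (χ : Set (Subgroup G)) (M : Rep.{u} k G) (H : Subgroup G) (hH : H ∈ χ) :
    ∃ s : M →ₗ[k] coverRep χ M, (∀ h ∈ H, ∀ b, s (M.ρ h b) = (coverRep χ M).ρ h (s b)) ∧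
      ∀ m, (coverMap χ M).hom (s m) = m := by
  refine ⟨coverIn χ M (coverBase ⟨H, hH⟩), fun h hh b => ?_, fun m => coverMap_in χ M _ m⟩
  rw [coverRep_in, smul_coverBase ⟨H, hH⟩ hh]

theorem coverRep_relProjective (χ : Set (Subgroup G)) (M : Rep.{u} k G) :
    IsRelProjective χ (coverRep χ M) := by
  intro X Y j φ hj hs
  choose s hs₁ hs₂ using hs
  have hs₃ : ∀ H hH y, j.hom (s H hH y) = y := by
    intro H hH y
    obtain ⟨x, rfl⟩ := hj y
    exact hs₂ H hH x
  let c : χ → (M →ₗ[k] X) := fun H =>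
    s H.1 H.2 ∘ₗ φ.hom.toLinearMap ∘ₗ coverIn χ M (coverBase H)
  have hφ : ∀ g i m, φ.hom (coverIn χ M (g • i) (M.ρ g m)) =
      Y.ρ g (φ.hom (coverIn χ M i m)) := by
    intro g i m
    rw [← Rep.hom_comm_apply, coverRep_in]
  have hc : ∀ H : χ, ∀ h ∈ H.1, ∀ m, c H (M.ρ h m) = X.ρ h (c H m) := by
    intro H h hh m
    have := hs₁ H.1 H.2 h hh (φ.hom (coverIn χ M (coverBase H) m))
    rw [← hφ, smul_coverBase H hh] at this
    exact this
  have hjc : ∀ (H : χ) m, j.hom (c H m) = φ.hom (coverIn χ M (coverBase H) m) :=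
    fun H m => hs₃ _ _ _
  have hM : ∀ (Z : Rep.{u} k G) (a b : G) (z : Z), Z.ρ a (Z.ρ b z) = Z.ρ (a * b) z := by
    intro Z a b z
    rw [map_mul]
    rfl
  let ψ : coverRep χ M →ₗ[k] X := coverDesc fun i =>
    X.ρ i.2.out ∘ₗ c i.1 ∘ₗ M.ρ i.2.out⁻¹
  have hψ : ∀ i m, ψ (coverIn χ M i m) = X.ρ i.2.out (c i.1 (M.ρ i.2.out⁻¹ m)) :=
    fun i m => coverDesc_in _ i m
  refine ⟨Rep.ofHom ⟨ψ, fun g => coverRep_ext fun i m => ?_⟩, ?_⟩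
  · change ψ ((coverRep χ M).ρ g (coverIn χ M i m)) = X.ρ g (ψ (coverIn χ M i m))
    rw [coverRep_in, hψ, hψ]
    have h3 := hc i.1 _ (out_smul_mem i g) (M.ρ i.2.out⁻¹ m)
    have e : (g • i).2.out⁻¹ * (g * i.2.out) * i.2.out⁻¹ = (g • i).2.out⁻¹ * g := by group
    rw [hM, e] at h3
    rw [hM]
    refine (congrArg (X.ρ (g • i).2.out) h3).trans ?_
    rw [hM, hM, mul_inv_cancel_left]
  · apply Rep.hom_ext
    apply Representation.IntertwiningMap.ext
    refine coverRep_ext fun i m => ?_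
    change j.hom (ψ (coverIn χ M i m)) = φ.hom (coverIn χ M i m)
    rw [hψ, Rep.hom_comm_apply, hjc, ← hφ, out_smul_coverBase, hM, mul_inv_cancel, map_one]
    rfl

/-- The kernel of `coverMap`. -/
def coverKer (χ : Set (Subgroup G)) (M : Rep.{u} k G) : Rep.{u} k G :=
  Rep.of (Representation.IntertwiningMap.ker _ _ (coverMap χ M).hom).toRepresentation

/-- The inclusion of the kernel of `coverMap`. -/
def coverKerIncl (χ : Set (Subgroup G)) (M : Rep.{u} k G) : coverKer χ M ⟶ coverRep χ M :=
  Rep.ofHom ⟨Submodule.subtype _, fun _ => rfl⟩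

theorem coverKerIncl_injective (χ : Set (Subgroup G)) (M : Rep.{u} k G) :
    Function.Injective (coverKerIncl χ M).hom := Subtype.val_injective

theorem coverKerIncl_exact (χ : Set (Subgroup G)) (M : Rep.{u} k G) :
    Function.Exact (coverKerIncl χ M).hom (coverMap χ M).hom := by
  intro x
  constructor
  · intro h
    exact ⟨⟨x, h⟩, rfl⟩
  · rintro ⟨y, rfl⟩
    exact y.2

theorem coverMap_surjective {χ : Set (Subgroup G)} (hχ : χ.Nonempty) (M : Rep.{u} k G) :
    Function.Surjective (coverMap χ M).hom := by
  obtain ⟨H, hH⟩ := hχ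
  obtain ⟨s, -, hs⟩ := coverMap_section χ M H hH
  exact fun m => ⟨s m, hs m⟩

theorem coverD_splits (χ : Set (Subgroup G)) (M : Rep.{u} k G) (H : Subgroup G) (hH : H ∈ χ) :
    SplitsOver H (coverMap χ (coverKer χ M) ≫ coverKerIncl χ M) := by
  obtain ⟨s, hs₁, hs₂⟩ := coverMap_section χ M H hH
  obtain ⟨t, ht₁, ht₂⟩ := coverMap_section χ (coverKer χ M) H hH
  let r : coverRep χ M →ₗ[k] coverKer χ M :=
    LinearMap.codRestrict (LinearMap.ker (coverMap χ M).hom.toLinearMap)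
      (LinearMap.id - s ∘ₗ (coverMap χ M).hom.toLinearMap) (fun x => by
        change (coverMap χ M).hom (x - s ((coverMap χ M).hom x)) = 0
        rw [map_sub, hs₂, sub_self])
  have hr : ∀ x, (coverKerIncl χ M).hom (r x) = x - s ((coverMap χ M).hom x) := fun _ => rfl
  refine ⟨t ∘ₗ r, ?_, ?_⟩
  · intro h hh b
    have : r ((coverRep χ M).ρ h b) = (coverKer χ M).ρ h (r b) := by
      apply coverKerIncl_injective
      rw [Rep.hom_comm_apply, hr, hr, Rep.hom_comm_apply, hs₁ h hh, map_sub]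
    change t (r ((coverRep χ M).ρ h b)) = _
    rw [this, ht₁ h hh]
    rfl
  · intro a
    change (coverKerIncl χ M).hom ((coverMap χ (coverKer χ M)).hom (t (r ((coverKerIncl χ M).hom
      ((coverMap χ (coverKer χ M)).hom a))))) = (coverKerIncl χ M).hom
        ((coverMap χ (coverKer χ M)).hom a)
    rw [ht₂, hr, (coverKerIncl_exact χ M _).2 ⟨_, rfl⟩, map_zero, sub_zero]

/-- Iterated kernels of `coverMap`. -/
def syzygy (χ : Set (Subgroup G)) (M : Rep.{u} k G) : ℕ → Rep.{u} k G
  | 0 => M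
  | i + 1 => coverKer χ (syzygy χ M i)

/-- Every module has a resolution that is projective relative to a given nonempty set of
subgroups. -/
theorem nonempty_relProjResolution {χ : Set (Subgroup G)} (hχ : χ.Nonempty) (M : Rep.{u} k G) :
    Nonempty (RelProjResolution χ M) :=
  ⟨{ Q := fun i => coverRep χ (syzygy χ M i)
     d := fun i => coverMap χ (coverKer χ (syzygy χ M i)) ≫ coverKerIncl χ (syzygy χ M i)
     ε := coverMap χ M
     relProjective := fun i => coverRep_relProjective χ _
     surjective := coverMap_surjective hχ M
     exact_zero := (coverMap_surjective hχ (coverKer χ M)).comp_exact_iff_exact.2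
        (coverKerIncl_exact χ M)
     exact_succ := fun i => ((coverMap_surjective hχ
        (coverKer χ (syzygy χ M (i + 1)))).comp_exact_iff_exact.2
          (coverKerIncl_exact χ (syzygy χ M (i + 1)))).comp_injective _
            (coverKerIncl_injective χ (syzygy χ M i)) (map_zero _)
     splits_ε := fun H hH => by
        obtain ⟨s, h₁, h₂⟩ := coverMap_section χ M H hH
        exact ⟨s, h₁, fun a => h₂ _⟩
     splits_d := fun i H hH => coverD_splits χ _ H hH }⟩

end General

section Klein

variable {k G : Type u} [Field k] [Group G]

/-- The set `χ` of the three subgroups generated by `σ`, `τ` and `σ τ`. In a Klein four-group with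
generators `σ`, `τ` these are all the proper nontrivial subgroups. -/
def kleinSubgroups (σ τ : G) : Set (Subgroup G) :=
  {Subgroup.zpowers σ, Subgroup.zpowers τ, Subgroup.zpowers (σ * τ)}

open Classical in
/-- The additive character `c` of the Klein four-group `{1, s, t, s t}` with values in `k` such
that `c s = c (s t) = 1` and `c 1 = c t = 0`. -/
def char (k : Type u) [Field k] (s t : G) (g : G) : k :=
  if g = s ∨ g = s * t then 1 else 0

theorem char_mul [CharP k 2] [IsKleinFour G] {s t : G} (hs : s ≠ 1) (ht : t ≠ 1)
    (hst : s ≠ t) (g h : G) : char k s t (g * h) = char k s t g + char k s t h := by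
  have h2 : (1 : k) + 1 = 0 := CharTwo.add_self_eq_zero 1
  have hss : s * s = 1 := IsKleinFour.mul_self s
  have htt : t * t = 1 := IsKleinFour.mul_self t
  have hcomm : t * s = s * t := by
    have := IsKleinFour.mul_self (s * t)
    calc t * s = (s * s) * (t * s) * (t * t) := by rw [hss, htt]; simp
      _ = s * ((s * t) * (s * t)) * t := by simp only [mul_assoc]
      _ = s * t := by rw [this]; simp
  have hst1 : s * t ≠ 1 := fun e => hst (by
    have := congrArg (· * t) e
    simpa [mul_assoc, htt] using this)
  have hsts : s * t ≠ s := fun e => ht (by simpa using e)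
  have hstt : s * t ≠ t := fun e => hs (by simpa using e)
  have key : ∀ g : G, g = 1 ∨ g = s ∨ g = t ∨ g = s * t := by
    classical
    intro g
    by_contra hg
    push Not at hg
    obtain ⟨g1, gs, gt, gst⟩ := hg
    exact gst (IsKleinFour.eq_mul_of_ne_all hs ht hst g1 gs gt)
  have a1 : s * (s * t) = t := by rw [← mul_assoc, hss, one_mul]
  have a2 : s * t * s = t := by rw [mul_assoc, hcomm, a1]
  have a3 : t * (s * t) = s := by rw [← mul_assoc, hcomm, mul_assoc, htt, mul_one]
  have a4 : s * t * t = s := by rw [mul_assoc, htt, mul_one]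
  have a5 : s * t * (s * t) = 1 := IsKleinFour.mul_self _
  have c1 : char k s t 1 = 0 := by
    simp [char, hs.symm, hst1.symm]
  have cs : char k s t s = 1 := by simp [char]
  have ct : char k s t t = 0 := by simp [char, hst.symm, hstt.symm]
  have cst : char k s t (s * t) = 1 := by simp [char]
  rcases key g with rfl | rfl | rfl | rfl <;> rcases key h with rfl | rfl | rfl | rfl <;>
    simp only [one_mul, mul_one, hss, htt, hcomm, a1, a2, a3, a4, a5, c1, cs, ct, cst, h2,
      add_zero, zero_add]

/-- The module over the Klein four-group `⟨σ, τ⟩` with basis `a_1, …, a_n, b_1, …, b_n` (the first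
and the second factor `kⁿ`), on which `σ - 1` and `τ - 1` kill every `b_j`, while
`(σ - 1) a_i = ∑_j A_{j i} b_j` and `(τ - 1) a_i = ∑_j B_{j i} b_j`. -/
def kleinRep [CharP k 2] [IsKleinFour G] {σ τ : G} (hσ : σ ≠ 1) (hτ : τ ≠ 1)
    (hστ : σ ≠ τ) {n : ℕ} (A B : Matrix (Fin n) (Fin n) k) : Rep.{u} k G :=
  Rep.of (X := (Fin n → k) × (Fin n → k))
    { toFun := fun g => LinearMap.id + LinearMap.inr k _ _ ∘ₗ
        (char k σ τ g • A.mulVecLin + char k τ σ g • B.mulVecLin) ∘ₗ LinearMap.fst k _ _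
      map_one' := by
        have h1 := char_mul (k := k) hσ hτ hστ 1 1
        have h2 := char_mul (k := k) hτ hσ hστ.symm 1 1
        simp only [mul_one, left_eq_add] at h1 h2
        rw [h1, h2]
        ext <;> simp
      map_mul' := fun g h => by
        rw [char_mul hσ hτ hστ, char_mul hτ hσ hστ.symm]
        refine LinearMap.ext fun x => Prod.ext ?_ ?_
        · simp
        · simp only [LinearMap.add_apply, LinearMap.id_apply, LinearMap.comp_apply,
            LinearMap.smul_apply, LinearMap.inr_apply, LinearMap.fst_apply, Prod.snd_add,
            Module.End.mul_apply, Prod.fst_add, add_zero]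
          module }

theorem kleinRep_apply [CharP k 2] [IsKleinFour G] {σ τ : G} (hσ : σ ≠ 1) (hτ : τ ≠ 1)
    (hστ : σ ≠ τ) {n : ℕ} (A B : Matrix (Fin n) (Fin n) k) (g : G) (u v : Fin n → k) :
    (kleinRep hσ hτ hστ A B).ρ g (u, v) =
      (u, v + (char k σ τ g • A.mulVec u + char k τ σ g • B.mulVec u)) := by
  change (u, v) + ((0 : Fin n → k), char k σ τ g • A.mulVec u + char k τ σ g • B.mulVec u) = _
  simp

theorem kleinRep_left [CharP k 2] [IsKleinFour G] {σ τ : G} (hσ : σ ≠ 1) (hτ : τ ≠ 1)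
    (hστ : σ ≠ τ) {n : ℕ} (A B : Matrix (Fin n) (Fin n) k) (u v : Fin n → k) :
    (kleinRep hσ hτ hστ A B).ρ σ (u, v) = (u, v + A.mulVec u) := by
  rw [kleinRep_apply]
  simp [char, hτ, hστ]
  rfl

theorem kleinRep_right [CharP k 2] [IsKleinFour G] {σ τ : G} (hσ : σ ≠ 1) (hτ : τ ≠ 1)
    (hστ : σ ≠ τ) {n : ℕ} (A B : Matrix (Fin n) (Fin n) k) (u v : Fin n → k) :
    (kleinRep hσ hτ hστ A B).ρ τ (u, v) = (u, v + B.mulVec u) := by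
  rw [kleinRep_apply]
  simp [char, hσ, hστ.symm]
  rfl

/-- The module `V_{2n,∞}`: `(σ - 1) a_i = b_i` for all `i`, `(τ - 1) a_i = b_{i+1}` for `i < n` and
`(τ - 1) a_n = 0`. -/
def VInfty [CharP k 2] [IsKleinFour G] {σ τ : G} (hσ : σ ≠ 1) (hτ : τ ≠ 1)
    (hστ : σ ≠ τ) (n : ℕ) : Rep.{u} k G :=
  kleinRep hσ hτ hστ (n := n) 1 (Matrix.of fun j i => if (j : ℕ) = i + 1 then 1 else 0)

/-- The module `V_{2n,θ}` for `θ = xⁿ + λ_1 xⁿ⁻¹ + … + λ_n`: `(τ - 1) a_i = b_i` for all `i`,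
`(σ - 1) a_i = b_{i-1}` for `i > 1` and `(σ - 1) a_1 = ∑_j λ_j b_j`. (Indices start at `0` in the
code, so that `b_j` is the basis vector number `j - 1`.) -/
def VTheta [CharP k 2] [IsKleinFour G] {σ τ : G} (hσ : σ ≠ 1) (hτ : τ ≠ 1)
    (hστ : σ ≠ τ) (n : ℕ) (θ : Polynomial k) : Rep.{u} k G :=
  kleinRep hσ hτ hστ (n := n)
    (Matrix.of fun j i => if (i : ℕ) = 0 then θ.coeff (n - 1 - j)
      else if (j : ℕ) + 1 = i then 1 else 0) 1

end Klein

end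

end RelCoh

namespace RelCoh

/-! ### Linear algebra of quotients and of the connecting homomorphism -/

section LinearAlgebra

variable {k : Type u} [Field k]

/-! Each module in question is `N = U × U` with `dim U = n`. The three involutions act by `(u, v) ↦
(u, v + R u)`, where `R` is `A` for `σ`, `B` for `τ` and `A + B` for `σ τ`. At most one of these
three maps is singular. For `V_{2n,∞}` they are the identity, a nilpotent shift and their sum. For
`V_{2n,θ}` they are a companion matrix `C`, the identity and `C + 1`, and `C + μ` is singular
exactly when `θ(μ) = 0`; a power of an irreducible polynomial cannot vanish at both `0` and `1`. A
singular map has a kernel of dimension one.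

Let `s`, `t` be generators such that `t` and `s t` act through injective maps `T` and `S + T`, and
let `c` be the additive character with kernel `⟨s⟩`. Tensoring `N` with the two-dimensional
representation defined by `c` gives a self-extension `0 → N → twist N → N → 0`. It splits over `⟨s⟩`
because `c` vanishes there, and over `⟨t⟩` and `⟨s t⟩` because `N` is free over both. So the
sequence is admissible for relative cohomology (`rank_ext_shift`). Its middle term is coinduced from
`⟨s⟩ ∈ χ`, hence has no relative cohomology in positive degrees (`twist_acyclic`).

The long exact sequence makes all `H^i` with `i > 0` equidimensional (`rank_ext_succ`) and presents
`H^1` as the cokernel of `H^0(twist N) → H^0(N)`. Here `H^0(N)` is the space of invariants `0 × U`,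
and the image of the invariants of `twist N` is `0 × T(ker S)`. Therefore `dim H^0 = n` and `dim H^i
= n - dim ker S` for `i > 0` (`rank_ext_of_pencil`). It remains to compute the kernels of the
matrices. -/

theorem rank_quotient_eq_of_map {Z Z' : Type u} [AddCommGroup Z] [Module k Z] [AddCommGroup Z']
    [Module k Z'] (f : Z →ₗ[k] Z') (B : Submodule k Z) (B' : Submodule k Z')
    (hB : ∀ z, f z ∈ B' ↔ z ∈ B) (hf : ∀ z', ∃ z, f z - z' ∈ B') :
    Module.rank k (Z ⧸ B) = Module.rank k (Z' ⧸ B') := by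
  have hker : B = LinearMap.ker (B'.mkQ ∘ₗ f) := by
    ext z
    simp [hB]
  have hsurj : Function.Surjective (B'.mkQ ∘ₗ f) := by
    intro y
    obtain ⟨z', rfl⟩ := B'.mkQ_surjective y
    obtain ⟨z, hz⟩ := hf z'
    exact ⟨z, (Submodule.Quotient.eq B').2 hz⟩
  exact ((Submodule.quotEquivOfEq _ _ hker).trans
    (LinearMap.quotKerEquivOfSurjective _ hsurj)).rank_eq

/-- The connecting homomorphism of a short exact sequence `0 → C → D → C → 0` of cochain complexes
whose middle term is acyclic in degree `i + 1`, as an equality of dimensions. -/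
theorem rank_connecting {C D : ℕ → Type u} [∀ i, AddCommGroup (C i)] [∀ i, Module k (C i)]
    [∀ i, AddCommGroup (D i)] [∀ i, Module k (D i)]
    (dC : ∀ i, C i →ₗ[k] C (i + 1)) (dD : ∀ i, D i →ₗ[k] D (i + 1))
    (ι : ∀ i, C i →ₗ[k] D i) (π : ∀ i, D i →ₗ[k] C i)
    (hι : ∀ i, Function.Injective (ι i)) (hπ : ∀ i, Function.Surjective (π i))
    (hex : ∀ i, Function.Exact (ι i) (π i))
    (hιd : ∀ i x, dD i (ι i x) = ι (i + 1) (dC i x))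
    (hπd : ∀ i x, dC i (π i x) = π (i + 1) (dD i x))
    (hD : ∀ i x, dD (i + 1) (dD i x) = 0)
    (hac : ∀ i x, dD (i + 1) x = 0 → ∃ y, dD i y = x) (i : ℕ) (B : Submodule k (C i))
    (hB : ∀ z, z ∈ B ↔ ∃ w, dD i w = 0 ∧ π i w = z) :
    Module.rank k (LinearMap.ker (dC i) ⧸ B.submoduleOf (LinearMap.ker (dC i))) =
      Module.rank k (LinearMap.ker (dC (i + 1)) ⧸
        (LinearMap.range (dC i)).submoduleOf (LinearMap.ker (dC (i + 1)))) := by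
  -- Over a field, `π` has a linear section and `ι` a linear retraction. With them the snake lemma's
  -- connecting map is an actual linear map `κ` on cochains, not merely on classes.
  obtain ⟨s, hs⟩ := (π i).exists_rightInverse_of_surjective (LinearMap.range_eq_top.2 (hπ i))
  obtain ⟨p, hp⟩ := (ι (i + 1)).exists_leftInverse_of_injective (LinearMap.ker_eq_bot.2 (hι _))
  replace hs : ∀ x, π i (s x) = x := fun x => LinearMap.congr_fun hs x
  replace hp : ∀ x, p (ι (i + 1) x) = x := fun x => LinearMap.congr_fun hp x
  let κ : C i →ₗ[k] C (i + 1) := p ∘ₗ dD i ∘ₗ s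
  have hκ : ∀ z, dC i z = 0 → ι (i + 1) (κ z) = dD i (s z) := by
    intro z hz
    have h : π (i + 1) (dD i (s z)) = 0 := by rw [← hπd, hs, hz]
    obtain ⟨y, hy⟩ := (hex _ _).1 h
    change ι (i + 1) (p (dD i (s z))) = _
    rw [← hy, hp]
  have hκd : ∀ z ∈ LinearMap.ker (dC i), κ z ∈ LinearMap.ker (dC (i + 1)) := by
    intro z hz
    apply hι
    rw [← hιd, hκ z hz, hD, map_zero]
  refine rank_quotient_eq_of_map (κ.restrict hκd) _ _ ?_ ?_
  -- Exactness at the cohomology of the quotient: `κ z` is a coboundary exactly when `z` lifts to a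
  -- cocycle of `D`. Keeping this image as `B`, instead of the coboundaries, covers degree `0` as
  -- well.
  · rintro ⟨z, hz⟩
    change (∃ y, dC i y = κ z) ↔ z ∈ B
    rw [hB]
    constructor
    · rintro ⟨y, hy⟩
      refine ⟨s z - ι i y, ?_, ?_⟩
      · rw [map_sub, hιd, hy, hκ z hz, sub_self]
      · rw [map_sub, hs, (hex i _).2 ⟨y, rfl⟩, sub_zero]
    · rintro ⟨w, hw, hwz⟩
      obtain ⟨y, hy⟩ := (hex i (s z - w)).1 (by rw [map_sub, hs, hwz, sub_self])
      refine ⟨y, hι _ ?_⟩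
      rw [← hιd, hy, map_sub, hw, sub_zero, hκ z hz]
  -- Surjectivity on classes: acyclicity of `D` writes `ι z'` as the coboundary of some `w`, and `π
  -- w` is then a preimage of the class of `z'`.
  · rintro ⟨z', hz'⟩
    obtain ⟨w, hw⟩ := hac i (ι (i + 1) z') (by rw [hιd, LinearMap.mem_ker.1 hz', map_zero])
    have hz : dC i (π i w) = 0 := by rw [hπd, hw]; exact (hex _ _).2 ⟨_, rfl⟩
    refine ⟨⟨π i w, hz⟩, ?_⟩
    obtain ⟨y, hy⟩ := (hex i (s (π i w) - w)).1 (by rw [map_sub, hs, sub_self])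
    change ∃ y, dC i y = κ (π i w) - z'
    refine ⟨y, hι _ ?_⟩
    rw [← hιd, hy, map_sub, hw, ← hκ _ hz, ← map_sub]

end LinearAlgebra

/-! ### The self-extension defined by an additive character -/

section Twist

variable {k G : Type u} [Field k] [Group G]

/-- The extension of `N` by itself defined by an additive character `c`: the tensor product of `N`
with the two-dimensional representation `g ↦ !![1, c g; 0, 1]`. -/
def twist (c : G → k) (hc : ∀ g h, c (g * h) = c g + c h) (N : Rep.{u} k G) : Rep.{u} k G :=
  Rep.of (X := N × N)
    { toFun := fun g => LinearMap.prod
        (N.ρ g ∘ₗ (LinearMap.fst k N N + c g • LinearMap.snd k N N))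
        (N.ρ g ∘ₗ LinearMap.snd k N N)
      map_one' := by
        have h := hc 1 1
        simp only [mul_one, left_eq_add] at h
        refine LinearMap.ext fun x => ?_
        simp [h]
      map_mul' := fun g h => by
        refine LinearMap.ext fun x => Prod.ext ?_ ?_
        · change N.ρ (g * h) (x.1 + c (g * h) • x.2) =
            N.ρ g (N.ρ h (x.1 + c h • x.2) + c g • N.ρ h x.2)
          rw [hc, map_mul, Module.End.mul_apply, ← map_smul, ← map_add]
          congr 2
          module
        · simp }

variable (c : G → k) (hc : ∀ g h, c (g * h) = c g + c h) (N : Rep.{u} k G)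

theorem twist_apply (g : G) (x y : N) :
    (twist c hc N).ρ g ((x, y) : N × N) = ((N.ρ g (x + c g • y), N.ρ g y) : N × N) := rfl

/-- The inclusion of `N` into its twisted double. -/
def twistIn : N ⟶ twist c hc N :=
  Rep.ofHom ⟨LinearMap.inl k N N, fun g => LinearMap.ext fun x => by
    change ((N.ρ g x, 0) : N × N) = (twist c hc N).ρ g ((x, 0) : N × N)
    rw [twist_apply]
    simp⟩

/-- The projection of the twisted double of `N` onto `N`. -/
def twistOut : twist c hc N ⟶ N :=
  Rep.ofHom ⟨LinearMap.snd k N N, fun _ => rfl⟩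

theorem twistOut_apply (x : N × N) : (twistOut c hc N).hom x = x.2 := rfl

theorem twistOut_surjective : Function.Surjective (twistOut c hc N).hom :=
  fun y => ⟨((0, y) : N × N), rfl⟩

theorem twist_exact : Function.Exact (twistIn c hc N).hom (twistOut c hc N).hom := by
  rintro ⟨x, y⟩
  constructor
  · rintro (rfl : y = 0)
    exact ⟨x, rfl⟩
  · rintro ⟨z, hz⟩
    exact (congrArg Prod.snd hz).symm

theorem hom_ext_apply {A B : Rep.{u} k G} {f g : A ⟶ B} (h : ∀ x, f.hom x = g.hom x) : f = g :=
  Rep.hom_ext (Representation.IntertwiningMap.ext (LinearMap.ext h))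

/-- A homomorphism that composes to zero with `p` factors through the kernel of `p`. -/
theorem exists_lift_of_exact {A B C Q : Rep.{u} k G} (i : A ⟶ B) (p : B ⟶ C)
    (hi : Function.Injective i.hom) (hip : Function.Exact i.hom p.hom) (f : Q ⟶ B)
    (hf : f ≫ p = 0) : ∃ g : Q ⟶ A, g ≫ i = f := by
  have hf' : ∀ q, ∃ a, i.hom a = f.hom q := fun q =>
    (hip _).1 (congrArg (fun φ : Q ⟶ C => φ.hom q) hf)
  choose a ha using hf'
  refine ⟨Rep.ofHom ⟨{ toFun := a, map_add' := ?_, map_smul' := ?_ }, fun g => ?_⟩, ?_⟩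
  · intro x y
    apply hi
    rw [map_add, ha, ha, ha, map_add]
  · intro r x
    apply hi
    rw [RingHom.id_apply, map_smul, ha, ha, map_smul]
  · refine LinearMap.ext fun x => hi ?_
    change i.hom (a (Q.ρ g x)) = i.hom (A.ρ g (a x))
    rw [ha, Rep.hom_comm_apply, Rep.hom_comm_apply, ha]
  · exact hom_ext_apply ha

theorem rep_add_self [CharP k 2] (N : Rep.{u} k G) (x : N) : x + x = 0 := by
  rw [← two_smul k x, CharTwo.two_eq_zero, zero_smul]

theorem d_comp_d {χ : Set (Subgroup G)} {M : Rep.{u} k G} (P : RelProjResolution χ M) (i : ℕ) :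
    P.d (i + 1) ≫ P.d i = 0 :=
  hom_ext_apply fun x => (P.exact_succ i _).2 ⟨x, rfl⟩

end Twist

/-! ### Splitting, acyclicity and dimension shifting over the Klein four-group -/

section KleinFour

variable {k G : Type u} [Field k] [Group G] [IsKleinFour G]

theorem klein_cases {s t : G} (hs : s ≠ 1) (ht : t ≠ 1) (hst : s ≠ t) (g : G) :
    g = 1 ∨ g = s ∨ g = t ∨ g = s * t := by
  classical
  by_contra hg
  push Not at hg
  obtain ⟨g1, gs, gt, gst⟩ := hg
  exact gst (IsKleinFour.eq_mul_of_ne_all hs ht hst g1 gs gt)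

theorem klein_comm (s t : G) : s * t = t * s :=
  mul_comm_of_exponent_two IsKleinFour.exponent_two s t

theorem klein_mul_ne_one {s t : G} (hst : s ≠ t) : s * t ≠ 1 := fun e => hst (by
  have := congrArg (· * t) e
  simpa [mul_assoc, IsKleinFour.mul_self t] using this)

theorem klein_apply_apply (N : Rep.{u} k G) (g : G) (x : N) : N.ρ g (N.ρ g x) = x := by
  rw [← Module.End.mul_apply, ← map_mul, IsKleinFour.mul_self, map_one, Module.End.one_apply]

theorem klein_apply_comm (N : Rep.{u} k G) (g h : G) (x : N) :
    N.ρ g (N.ρ h x) = N.ρ h (N.ρ g x) := by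
  rw [← Module.End.mul_apply, ← Module.End.mul_apply, ← map_mul, ← map_mul, klein_comm]

theorem klein_mem_zpowers {a h : G} (hh : h ∈ Subgroup.zpowers a) : h = 1 ∨ h = a := by
  obtain ⟨n, rfl⟩ := Subgroup.mem_zpowers_iff.1 hh
  have haa : a * a = 1 := IsKleinFour.mul_self a
  obtain ⟨m, rfl | rfl⟩ := Int.even_or_odd' n
  · left
    rw [zpow_mul, zpow_ofNat, pow_two, haa, one_zpow]
  · right
    rw [zpow_add, zpow_mul, zpow_ofNat, pow_two, haa, one_zpow, one_mul, zpow_one]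

theorem splitsOver_zpowers {A B : Rep.{u} k G} (f : A ⟶ B) (a : G) (r : B →ₗ[k] A)
    (hr : ∀ b, r (B.ρ a b) = A.ρ a (r b)) (hf : ∀ b, f.hom (r b) = b) :
    SplitsOver (Subgroup.zpowers a) f := by
  refine ⟨r, fun h hh b => ?_, fun a => hf _⟩
  rcases klein_mem_zpowers hh with rfl | rfl
  · simp
  · exact hr b

/-- A linear map that commutes with two generators is a homomorphism of representations. -/
theorem exists_hom_of_generators {s t : G} (hs : s ≠ 1) (ht : t ≠ 1) (hst : s ≠ t)
    {A B : Rep.{u} k G} (f : A →ₗ[k] B) (hfs : ∀ x, f (A.ρ s x) = B.ρ s (f x))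
    (hft : ∀ x, f (A.ρ t x) = B.ρ t (f x)) : ∃ φ : A ⟶ B, ∀ x, φ.hom x = f x := by
  refine ⟨Rep.ofHom ⟨f, fun g => LinearMap.ext fun x => ?_⟩, fun _ => rfl⟩
  change f (A.ρ g x) = B.ρ g (f x)
  rcases klein_cases hs ht hst g with rfl | rfl | rfl | rfl
  · simp
  · exact hfs x
  · exact hft x
  · rw [map_mul, map_mul, Module.End.mul_apply, Module.End.mul_apply, hfs, hft]

theorem twistOut_splits_of_eq_zero (c : G → k) (hc : ∀ g h, c (g * h) = c g + c h)
    (N : Rep.{u} k G) {a : G} (ha : c a = 0) :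
    SplitsOver (Subgroup.zpowers a) (twistOut c hc N) := by
  refine splitsOver_zpowers _ a (LinearMap.inr k N N) (fun b => ?_) fun b => rfl
  change ((0, N.ρ a b) : N × N) = (twist c hc N).ρ a ((0, b) : N × N)
  rw [twist_apply, ha]
  simp

variable [CharP k 2]

/-- The hypothesis on `r` is Higman's criterion: the identity is the trace of `r` from the trivial
group, so `N` is projective over `⟨a⟩` and the extension splits there. The explicit section is `y ↦
(r (a y), y)`. -/
theorem twistOut_splits_of_free (c : G → k) (hc : ∀ g h, c (g * h) = c g + c h)
    (N : Rep.{u} k G) {a : G} (ha : c a = 1) (r : N →ₗ[k] N)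
    (hr : ∀ x, r (N.ρ a x) + N.ρ a (r x) = x) :
    SplitsOver (Subgroup.zpowers a) (twistOut c hc N) := by
  refine splitsOver_zpowers _ a ((r ∘ₗ N.ρ a).prod LinearMap.id) (fun b => ?_) fun b => rfl
  change ((r (N.ρ a (N.ρ a b)), N.ρ a b) : N × N) =
    (twist c hc N).ρ a ((r (N.ρ a b), b) : N × N)
  rw [twist_apply, ha, one_smul, map_add]
  refine Prod.ext ?_ rfl
  have h := congrArg (· + N.ρ a (r (N.ρ a b))) (hr (N.ρ a b))
  simp only [add_assoc, rep_add_self, add_zero] at h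
  rw [h]
  exact add_comm _ _

/-- The twisted double of `N` is coinduced from the kernel of `c`; therefore homomorphisms to it
extend along maps that split over this kernel. -/
theorem twist_acyclic {s t : G} (hs : s ≠ 1) (ht : t ≠ 1) (hst : s ≠ t) (c : G → k)
    (hc : ∀ g h, c (g * h) = c g + c h) (hcs : c s = 0) (hct : c t = 1) (N : Rep.{u} k G)
    {A B C : Rep.{u} k G} (f : A ⟶ B) (g : B ⟶ C) (hfg : Function.Exact f.hom g.hom)
    (hg : SplitsOver (Subgroup.zpowers s) g) (φ : B ⟶ twist c hc N) (hφ : f ≫ φ = 0) :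
    ∃ ψ : C ⟶ twist c hc N, g ≫ ψ = φ := by
  obtain ⟨r, hr, hgr⟩ := hg
  replace hr := hr s (Subgroup.mem_zpowers s)
  -- The map `e` commutes with `s`, and `e + t e t = 1`: the identity of the twist is a trace from
  -- `⟨s⟩`, which expresses relative projectivity and relative injectivity with respect to `⟨s⟩`.
  let e : twist c hc N →ₗ[k] twist c hc N :=
    LinearMap.inr k N N ∘ₗ (LinearMap.fst k N N + LinearMap.snd k N N)
  have he : ∀ x y : N, e ((x, y) : N × N) = ((0, x + y) : N × N) := fun _ _ => rfl
  have hes : ∀ z, e ((twist c hc N).ρ s z) = (twist c hc N).ρ s (e z) := by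
    rintro ⟨x, y⟩
    rw [twist_apply, he, he, twist_apply, hcs]
    simp only [zero_smul, add_zero, map_add]
    exact Prod.ext (map_zero (N.ρ s)).symm rfl
  have het : ∀ z, e z + (twist c hc N).ρ t (e ((twist c hc N).ρ t z)) = z := by
    rintro ⟨x, y⟩
    rw [twist_apply, he, he, twist_apply, hct]
    change ((0 + N.ρ t _, x + y + N.ρ t _) : N × N) = (x, y)
    simp only [one_smul, map_add, klein_apply_apply, zero_add]
    rw [add_assoc, rep_add_self, add_zero, add_comm x y, add_assoc, rep_add_self, add_zero]
  -- `θ` extends `φ` along `g`, but only `s`-equivariantly. The trace `e θ + t e θ t` repairs this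
  -- and still restricts to `φ` because `e + t e t = 1`.
  let θ : C →ₗ[k] twist c hc N := φ.hom.toLinearMap ∘ₗ r
  have hθ : ∀ x, θ x = φ.hom (r x) := fun _ => rfl
  have hθs : ∀ x, θ (C.ρ s x) = (twist c hc N).ρ s (θ x) := by
    intro x
    rw [hθ, hr, Rep.hom_comm_apply, ← hθ]
  have hθg : ∀ x, θ (g.hom x) = φ.hom x := by
    intro x
    obtain ⟨y, hy⟩ := (hfg (r (g.hom x) - x)).1 (by rw [map_sub, hgr, sub_self])
    have h : φ.hom (f.hom y) = 0 := congrArg (fun ψ : A ⟶ twist c hc N => ψ.hom y) hφ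
    rw [hy, map_sub, sub_eq_zero] at h
    exact h
  obtain ⟨ψ, hψ⟩ := exists_hom_of_generators hs ht hst
    (e ∘ₗ θ + (twist c hc N).ρ t ∘ₗ e ∘ₗ θ ∘ₗ C.ρ t)
    (fun x => by
      change e (θ (C.ρ s x)) + (twist c hc N).ρ t (e (θ (C.ρ t (C.ρ s x)))) =
        (twist c hc N).ρ s (e (θ x) + (twist c hc N).ρ t (e (θ (C.ρ t x))))
      rw [klein_apply_comm C, hθs, hθs, hes, hes, klein_apply_comm _ t s, map_add])
    (fun x => by
      change e (θ (C.ρ t x)) + (twist c hc N).ρ t (e (θ (C.ρ t (C.ρ t x)))) =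
        (twist c hc N).ρ t (e (θ x) + (twist c hc N).ρ t (e (θ (C.ρ t x))))
      rw [map_add, klein_apply_apply, klein_apply_apply, add_comm])
  refine ⟨ψ, hom_ext_apply fun x => ?_⟩
  change ψ.hom (g.hom x) = _
  rw [hψ]
  change e (θ (g.hom x)) + (twist c hc N).ρ t (e (θ (C.ρ t (g.hom x)))) = _
  rw [← Rep.hom_comm_apply, hθg, hθg, Rep.hom_comm_apply, het]

variable {χ : Set (Subgroup G)} {M : Rep.{u} k G} (P : RelProjResolution χ M)

/-- Dimension shifting along `0 → N → twist N → N → 0`. -/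
theorem rank_ext_shift {s t : G} (hs : s ≠ 1) (ht : t ≠ 1) (hst : s ≠ t) (c : G → k)
    (hc : ∀ g h, c (g * h) = c g + c h) (hcs : c s = 0) (hct : c t = 1) (N : Rep.{u} k G)
    (hχ : Subgroup.zpowers s ∈ χ) (hsplit : ∀ H ∈ χ, SplitsOver H (twistOut c hc N))
    (i : ℕ) (B : Submodule k (P.Q i ⟶ N))
    (hB : ∀ z, z ∈ B ↔ ∃ w : P.Q i ⟶ twist c hc N, P.d i ≫ w = 0 ∧ w ≫ twistOut c hc N = z) :
    Module.rank k (LinearMap.ker (P.δ N i) ⧸ B.submoduleOf (LinearMap.ker (P.δ N i))) =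
      Module.rank k (P.Ext N (i + 1)) := by
  -- Relative projectivity of `Q i` makes `Hom(Q i, -)` exact on the extension, since this splits
  -- over every member of `χ`. Acyclicity of the middle complex is `twist_acyclic`.
  refine rank_connecting (C := fun i => (P.Q i ⟶ N)) (D := fun i => (P.Q i ⟶ twist c hc N))
    (P.δ N) (P.δ (twist c hc N))
    (fun i => Linear.rightComp k (P.Q i) (twistIn c hc N))
    (fun i => Linear.rightComp k (P.Q i) (twistOut c hc N))
    (fun i f g hfg => hom_ext_apply fun x => ?_)
    (fun i f => P.relProjective i _ f (twistOut_surjective c hc N) hsplit)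
    (fun i f => ⟨fun hf => ?_, ?_⟩) (fun i f => (Category.assoc (P.d i) f (twistIn c hc N)).symm)
    (fun i f => (Category.assoc (P.d i) f (twistOut c hc N)).symm)
    (fun i f => ?_)
    (fun i f hf => twist_acyclic hs ht hst c hc hcs hct N _ _ (P.exact_succ i)
      (P.splits_d i _ hχ) f hf) i B hB
  · exact congrArg Prod.fst (congrArg (fun φ : P.Q i ⟶ twist c hc N => φ.hom x) hfg)
  · exact exists_lift_of_exact _ _ (fun x y h => congrArg Prod.fst h) (twist_exact c hc N) f hf
  · rintro ⟨g, rfl⟩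
    exact hom_ext_apply fun x => rfl
  · change P.d (i + 1) ≫ P.d i ≫ f = 0
    rw [← Category.assoc, d_comp_d, Limits.zero_comp]

/-- In positive degrees the cocycles of `N` that lift to cocycles of the twist are just the
coboundaries: coboundaries lift by relative projectivity, and a cocycle of the twist is a coboundary
by acyclicity. -/
theorem rank_ext_succ {s t : G} (hs : s ≠ 1) (ht : t ≠ 1) (hst : s ≠ t) (c : G → k)
    (hc : ∀ g h, c (g * h) = c g + c h) (hcs : c s = 0) (hct : c t = 1) (N : Rep.{u} k G)
    (hχ : Subgroup.zpowers s ∈ χ) (hsplit : ∀ H ∈ χ, SplitsOver H (twistOut c hc N)) (i : ℕ) :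
    Module.rank k (P.Ext N (i + 1)) = Module.rank k (P.Ext N (i + 2)) := by
  refine rank_ext_shift P hs ht hst c hc hcs hct N hχ hsplit (i + 1) _ fun z => ?_
  constructor
  · rintro ⟨y, rfl⟩
    obtain ⟨w, rfl⟩ := P.relProjective i _ y (twistOut_surjective c hc N) hsplit
    refine ⟨P.d i ≫ w, ?_, Category.assoc _ _ _⟩
    rw [← Category.assoc, d_comp_d, Limits.zero_comp]
  · rintro ⟨w, hw, rfl⟩
    obtain ⟨y, rfl⟩ := twist_acyclic hs ht hst c hc hcs hct N _ _ (P.exact_succ i)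
      (P.splits_d i _ hχ) w hw
    exact ⟨y ≫ twistOut c hc N, (Category.assoc (P.d i) y (twistOut c hc N)).symm⟩

end KleinFour

/-! ### Degree zero: cocycles as invariants -/

section Trivial

variable {k G : Type u} [Field k] [Group G] {χ : Set (Subgroup G)}
  (P : RelProjResolution χ (Rep.trivial k G k))

/-- The element `x - ε(x) q` lies in `ker ε = im d 0`, where a cocycle vanishes. So a degree-zero
cocycle is determined by its value at `q`; the next lemmas show that these values are exactly the
invariants of `N`. -/
theorem apply_eq_augmentation_smul {N : Rep.{u} k G} {f : P.Q 0 ⟶ N} (hf : P.d 0 ≫ f = 0)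
    {q : P.Q 0} (hq : P.ε.hom q = (1 : k)) (x : P.Q 0) :
    f.hom x = (show k from P.ε.hom x) • f.hom q := by
  obtain ⟨y, hy⟩ := (P.exact_zero (x - (show k from P.ε.hom x) • q)).1 (by
    rw [map_sub, map_smul, hq]
    change (P.ε.hom x : k) - (P.ε.hom x : k) * 1 = 0
    rw [mul_one, sub_self])
  have h : f.hom ((P.d 0).hom y) = 0 := congrArg (fun φ : P.Q 1 ⟶ N => φ.hom y) hf
  rw [hy, map_sub, map_smul, sub_eq_zero] at h
  exact h

theorem cocycle_ext {N : Rep.{u} k G} {f g : P.Q 0 ⟶ N} (hf : P.d 0 ≫ f = 0)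
    (hg : P.d 0 ≫ g = 0) {q : P.Q 0} (hq : P.ε.hom q = (1 : k)) (h : f.hom q = g.hom q) :
    f = g := by
  refine hom_ext_apply fun x => ?_
  rw [apply_eq_augmentation_smul P hf hq, apply_eq_augmentation_smul P hg hq, h]

theorem cocycle_invariant {N : Rep.{u} k G} {f : P.Q 0 ⟶ N} (hf : P.d 0 ≫ f = 0)
    {q : P.Q 0} (hq : P.ε.hom q = (1 : k)) (g : G) : N.ρ g (f.hom q) = f.hom q := by
  have h := apply_eq_augmentation_smul P hf hq ((P.Q 0).ρ g q)
  rw [Rep.hom_comm_apply, Rep.hom_comm_apply] at h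
  rw [h]
  change (P.ε.hom q : k) • _ = _
  rw [hq, one_smul]

theorem exists_cocycle {N : Rep.{u} k G} {q : P.Q 0} (hq : P.ε.hom q = (1 : k)) (x : N)
    (hx : ∀ g, N.ρ g x = x) : ∃ f : P.Q 0 ⟶ N, P.d 0 ≫ f = 0 ∧ f.hom q = x := by
  let ε : P.Q 0 →ₗ[k] k := P.ε.hom.toLinearMap
  have hε : ∀ y, P.ε.hom y = ε y := fun _ => rfl
  refine ⟨Rep.ofHom ⟨ε.smulRight x, fun g => LinearMap.ext fun y => ?_⟩,
    hom_ext_apply fun y => ?_, ?_⟩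
  · change ε ((P.Q 0).ρ g y) • x = N.ρ g (ε y • x)
    rw [map_smul, hx, ← hε, Rep.hom_comm_apply]
    rfl
  · change ε ((P.d 0).hom y) • x = 0
    rw [← hε, (P.exact_zero _).2 ⟨y, rfl⟩]
    exact zero_smul k x
  · change ε q • x = x
    rw [← hε, hq, one_smul]

end Trivial

/-! ### Cohomology of a module given by a pencil of linear maps -/

section Pencil

variable {k G : Type u} [Field k] [Group G] {N : Rep.{u} k G}
  {U : Type u} [AddCommGroup U] [Module k U]

/-- By finite dimension `T` is invertible, and `r (u, v) = (T⁻¹ v, 0)` works: `r a` sends `(u, v)`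
to `(T⁻¹ v + u, 0)`, `a r` sends it to `(T⁻¹ v, v)`, and in characteristic `2` the sum is `(u, v)`.
-/
theorem exists_add_eq_of_injective [CharP k 2] [FiniteDimensional k U] (e : N ≃ₗ[k] U × U) (a : G)
    (T : U →ₗ[k] U) (hT : ∀ x, e (N.ρ a x) = ((e x).1, (e x).2 + T (e x).1))
    (hinj : Function.Injective T) :
    ∃ r : N →ₗ[k] N, ∀ x, r (N.ρ a x) + N.ρ a (r x) = x := by
  let T' : U ≃ₗ[k] U := LinearEquiv.ofInjectiveEndo T hinj
  have hT' : ∀ u, T (T'.symm u) = u := fun u => T'.apply_symm_apply u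
  have hT'' : ∀ u, T'.symm (T u) = u := fun u => T'.symm_apply_apply u
  refine ⟨e.symm.toLinearMap ∘ₗ LinearMap.inl k U U ∘ₗ T'.symm.toLinearMap ∘ₗ
    LinearMap.snd k U U ∘ₗ e.toLinearMap, fun x => e.injective ?_⟩
  change e (e.symm (T'.symm (e (N.ρ a x)).2, 0) + N.ρ a (e.symm (T'.symm (e x).2, 0))) = e x
  rw [map_add, hT, hT, e.apply_symm_apply, e.apply_symm_apply, map_add, hT', hT'']
  refine Prod.ext ?_ ?_
  · change T'.symm (e x).2 + (e x).1 + T'.symm (e x).2 = (e x).1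
    rw [add_right_comm, ← two_smul k, CharTwo.two_eq_zero, zero_smul, zero_add]
  · change 0 + (0 + (e x).2) = (e x).2
    rw [zero_add, zero_add]

variable [IsKleinFour G]

theorem klein_invariant {s t : G} (hs : s ≠ 1) (ht : t ≠ 1) (hst : s ≠ t) {x : N}
    (hxs : N.ρ s x = x) (hxt : N.ρ t x = x) (g : G) : N.ρ g x = x := by
  rcases klein_cases hs ht hst g with rfl | rfl | rfl | rfl
  · simp
  · exact hxs
  · exact hxt
  · rw [map_mul, Module.End.mul_apply, hxt, hxs]

variable [CharP k 2] [FiniteDimensional k U]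

/-- Let `s`, `t` generate the Klein four-group, and let them act on `N = U × U` by
`(u, v) ↦ (u, v + S u)` and `(u, v) ↦ (u, v + T u)`, where `T` and `S + T` are injective. -/
theorem rank_ext_of_pencil {s t : G} (hs : s ≠ 1) (ht : t ≠ 1) (hst : s ≠ t)
    (e : N ≃ₗ[k] U × U) (S T : U →ₗ[k] U)
    (hS : ∀ x, e (N.ρ s x) = ((e x).1, (e x).2 + S (e x).1))
    (hT : ∀ x, e (N.ρ t x) = ((e x).1, (e x).2 + T (e x).1))
    (hTinj : Function.Injective T) (hSTinj : Function.Injective (S + T))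
    {χ : Set (Subgroup G)} (hχ : χ = kleinSubgroups s t)
    (P : RelProjResolution χ (Rep.trivial k G k)) :
    Module.rank k (P.Ext N 0) = Module.finrank k U ∧
      ∀ i, Module.rank k (P.Ext N (i + 1)) =
        (Module.finrank k U - Module.finrank k (LinearMap.ker S) : ℕ) := by
  subst hχ
  -- The character with kernel `⟨s⟩`. The extension thus splits trivially over `⟨s⟩`, the only
  -- subgroup over which `N` may fail to be free.
  let c : G → k := char k t s
  have hc : ∀ g h, c (g * h) = c g + c h := char_mul ht hs hst.symm
  have hct : c t = 1 := by simp [c, char]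
  have hcs : c s = 0 := by
    have h1 : s ≠ t * s := fun h => ht (by simpa using h.symm)
    simp [c, char, hst, h1]
  have hST : ∀ x, e (N.ρ (s * t) x) = ((e x).1, (e x).2 + (S + T) (e x).1) := by
    intro x
    rw [map_mul, Module.End.mul_apply, hS, hT, LinearMap.add_apply, add_assoc, add_comm (T _)]
  have hsplit : ∀ H ∈ kleinSubgroups s t, SplitsOver H (twistOut c hc N) := by
    rintro H (rfl | rfl | rfl)
    · exact twistOut_splits_of_eq_zero c hc N hcs
    · obtain ⟨r, hr⟩ := exists_add_eq_of_injective e t T hT hTinj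
      exact twistOut_splits_of_free c hc N hct r hr
    · obtain ⟨r, hr⟩ := exists_add_eq_of_injective e (s * t) (S + T) hST hSTinj
      exact twistOut_splits_of_free c hc N (by rw [hc, hcs, hct, zero_add]) r hr
  have hχ : Subgroup.zpowers s ∈ kleinSubgroups s t := Or.inl rfl
  obtain ⟨q, hq⟩ := P.surjective (1 : k)
  have hinv : ∀ v g, N.ρ g (e.symm (0, v)) = e.symm (0, v) := by
    intro v
    refine klein_invariant hs ht hst (e.injective ?_) (e.injective ?_)
    · rw [hS, e.apply_symm_apply, map_zero, add_zero]
    · rw [hT, e.apply_symm_apply, map_zero, add_zero]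
  have hfst : ∀ f : P.Q 0 ⟶ N, P.d 0 ≫ f = 0 → (e (f.hom q)).1 = 0 := by
    intro f hf
    have h := congrArg e (cocycle_invariant P hf hq t)
    rw [hT] at h
    have h2 := congrArg Prod.snd h
    exact hTinj ((add_eq_left.1 h2).trans (map_zero T).symm)
  -- Evaluation at `q`, followed by the second coordinate, identifies the degree-zero cocycles with
  -- `U`: injectivity of `T` forces the first coordinate of an invariant to vanish.
  let κ : LinearMap.ker (P.δ N 0) →ₗ[k] U :=
    { toFun := fun f => (e (f.1.hom q)).2
      map_add' := fun f g => by
        change (e (f.1.hom q + g.1.hom q)).2 = _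
        rw [map_add]
        rfl
      map_smul' := fun a f => by
        change (e (a • f.1.hom q)).2 = _
        rw [map_smul]
        rfl }
  have hκ : ∀ f : LinearMap.ker (P.δ N 0), e (f.1.hom q) = (0, κ f) := fun f =>
    Prod.ext (hfst f.1 f.2) rfl
  have hκsurj : ∀ v, ∃ f, κ f = v := by
    intro v
    obtain ⟨f, hf, hfq⟩ := exists_cocycle P hq (e.symm (0, v)) (hinv v)
    refine ⟨⟨f, hf⟩, ?_⟩
    change (e (f.hom q)).2 = v
    rw [hfq, e.apply_symm_apply]
  have hκinj : ∀ f, κ f = 0 → f = 0 := by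
    intro f hf
    refine Subtype.ext (cocycle_ext P f.2 Limits.comp_zero hq (e.injective ?_))
    rw [hκ, hf]
    exact (map_zero e).symm
  have h0 : Module.rank k (P.Ext N 0) = Module.finrank k U := by
    rw [rank_quotient_eq_of_map κ _ ⊥ (fun f => ?_) (fun v => ?_),
      ← Module.finrank_eq_rank, (Submodule.quotEquivOfEqBot (⊥ : Submodule k U) rfl).finrank_eq]
    · change κ f = 0 ↔ f.1 = 0
      refine ⟨fun h => congrArg Subtype.val (hκinj f h), fun h => ?_⟩
      rw [show f = 0 from Subtype.ext h, map_zero]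
    · obtain ⟨f, hf⟩ := hκsurj v
      exact ⟨f, by rw [hf, sub_self]; exact Submodule.zero_mem _⟩
  have h1 : Module.rank k (P.Ext N 1) =
      (Module.finrank k U - Module.finrank k (LinearMap.ker S) : ℕ) := by
    -- `B` is the image of `H^0(twist N)` in `H^0(N)`. Under `κ` it corresponds to `T(ker S)`, of
    -- dimension `dim ker S` because `T` is injective.
    let B : Submodule k (P.Q 0 ⟶ N) := (LinearMap.ker (P.δ (twist c hc N) 0)).map
      (Linear.rightComp k (P.Q 0) (twistOut c hc N))
    rw [← rank_ext_shift P hs ht hst c hc hcs hct N hχ hsplit 0 B (fun z => Iff.rfl),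
      rank_quotient_eq_of_map κ _ ((LinearMap.ker S).map T) (fun f => ?_) (fun v => ?_),
      ← Module.finrank_eq_rank, Submodule.finrank_quotient,
      ← (Submodule.equivMapOfInjective T hTinj (LinearMap.ker S)).finrank_eq]
    · constructor
      · rintro ⟨u, hu, huv⟩
        -- The pair is fixed by `s` because `S u = 0`, and by `t` because `T u = κ f` cancels
        -- against `κ f` in characteristic `2`.
        have hx : ∀ g, (twist c hc N).ρ g ((e.symm (u, 0), e.symm (0, κ f)) : N × N) =
            ((e.symm (u, 0), e.symm (0, κ f)) : N × N) := by
          refine klein_invariant hs ht hst ?_ ?_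
          · rw [twist_apply, hcs, zero_smul, add_zero, hinv]
            refine Prod.ext (e.injective ?_) rfl
            rw [hS, e.apply_symm_apply, LinearMap.mem_ker.1 hu, add_zero]
          · rw [twist_apply, hct, one_smul, hinv]
            refine Prod.ext (e.injective ?_) rfl
            rw [hT, map_add, e.apply_symm_apply, e.apply_symm_apply]
            change (u + 0, 0 + κ f + T (u + 0)) = (u, 0)
            rw [add_zero, zero_add, huv, ← two_smul k, CharTwo.two_eq_zero, zero_smul]
        obtain ⟨w, hw, hwq⟩ := exists_cocycle P hq _ hx
        refine ⟨w, hw, cocycle_ext P ?_ f.2 hq (e.injective ?_)⟩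
        · change P.d 0 ≫ w ≫ twistOut c hc N = 0
          rw [← Category.assoc, show P.d 0 ≫ w = 0 from hw, Limits.zero_comp]
        · change e ((twistOut c hc N).hom (w.hom q)) = _
          rw [hwq, twistOut_apply, e.apply_symm_apply]
          exact (hκ f).symm
      · rintro ⟨w, hw, hwf⟩
        have hwf' : (twistOut c hc N).hom (w.hom q) = f.1.hom q :=
          congrArg (fun φ : P.Q 0 ⟶ N => φ.hom q) hwf
        have hws := cocycle_invariant P hw hq s
        have hwt := cocycle_invariant P hw hq t
        generalize w.hom q = z at hwf' hws hwt
        obtain ⟨x, y⟩ := z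
        obtain rfl : y = f.1.hom q := hwf'
        rw [twist_apply] at hws hwt
        have h1 := congrArg (fun z : N × N => e z.1) hws
        have h2 := congrArg (fun z : N × N => e z.1) hwt
        simp only [hS, hT, hcs, hct, zero_smul, one_smul, add_zero, map_add, hκ] at h1 h2
        -- Invariance under `s` gives `S (e x).1 = 0`, and invariance under `t` gives `T (e x).1 + κ
        -- f = 0`, whence the sign.
        refine ⟨-(e x).1, ?_, ?_⟩
        · rw [SetLike.mem_coe, LinearMap.mem_ker, map_neg, neg_eq_zero]
          exact add_eq_left.1 (congrArg Prod.snd h1)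
        · have h3 := congrArg Prod.snd h2
          simp only [Prod.snd_add, add_assoc, add_eq_left, map_zero, add_zero] at h3
          rw [map_neg]
          exact (eq_neg_of_add_eq_zero_right h3).symm
    · obtain ⟨f, hf⟩ := hκsurj v
      exact ⟨f, by rw [hf, sub_self]; exact Submodule.zero_mem _⟩
  refine ⟨h0, fun i => ?_⟩
  induction i with
  | zero => exact h1
  | succ i ih => rw [← ih, ← rank_ext_succ P hs ht hst c hc hcs hct N hχ hsplit i]

end Pencil

/-! ### Kernels of the shift and companion matrices -/

section Matrices

variable {k : Type u} [Field k]

/-- The endomorphism `σ - 1` of `V_{2n,θ}`, from the span of the `a_i` to the span of the `b_j`. -/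
def companion (n : ℕ) (θ : Polynomial k) : Matrix (Fin n) (Fin n) k :=
  Matrix.of fun j i => if (i : ℕ) = 0 then θ.coeff (n - 1 - j)
    else if (j : ℕ) + 1 = i then 1 else 0

/-- The endomorphism `τ - 1` of `V_{2n,∞}`, from the span of the `a_i` to the span of the `b_j`. -/
def shift (k : Type u) [Field k] (n : ℕ) : Matrix (Fin n) (Fin n) k :=
  Matrix.of fun j i => if (j : ℕ) = i + 1 then 1 else 0

theorem companion_mulVec {n : ℕ} (θ : Polynomial k) (u : Fin (n + 1) → k) (j : Fin (n + 1)) :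
    (companion (n + 1) θ).mulVec u j =
      θ.coeff (n - j) * u 0 + if h : (j : ℕ) < n then u ⟨j + 1, by omega⟩ else 0 := by
  have h : ∑ i : Fin n, companion (n + 1) θ j i.succ * u i.succ =
      if h : (j : ℕ) < n then u ⟨j + 1, by omega⟩ else 0 := by
    simp only [companion, Matrix.of_apply, Fin.val_succ, Nat.succ_ne_zero, if_false,
      Nat.add_right_cancel_iff, ite_mul, one_mul, zero_mul]
    split_ifs with h
    · rw [Finset.sum_eq_single (⟨j, h⟩ : Fin n)]
      · simp
      · intro b _ hb
        rw [if_neg]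
        intro hj
        exact hb (Fin.ext hj.symm)
      · simp
    · refine Finset.sum_eq_zero fun b _ => if_neg ?_
      have := b.2
      omega
  rw [← h, Matrix.mulVec, dotProduct, Fin.sum_univ_succ]
  simp [companion]

theorem one_mulVecLin_injective (n : ℕ) :
    Function.Injective (1 : Matrix (Fin n) (Fin n) k).mulVecLin := by
  rw [Matrix.mulVecLin_one]
  exact Function.injective_id

theorem shift_mulVec {n : ℕ} (u : Fin (n + 1) → k) (j : Fin n) :
    (shift k (n + 1)).mulVec u j.succ = u j.castSucc := by
  rw [Matrix.mulVec, dotProduct, Finset.sum_eq_single j.castSucc]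
  · simp [shift]
  · intro b _ hb
    simp only [shift, Matrix.of_apply, Fin.val_succ, Nat.add_right_cancel_iff]
    rw [if_neg, zero_mul]
    intro hj
    exact hb (Fin.ext hj.symm)
  · simp

theorem shift_mulVec_zero {n : ℕ} (u : Fin (n + 1) → k) :
    (shift k (n + 1)).mulVec u 0 = 0 := by
  rw [Matrix.mulVec, dotProduct]
  exact Finset.sum_eq_zero fun b _ => by simp [shift]

theorem shift_ker {n : ℕ} (u : Fin (n + 1) → k) :
    (shift k (n + 1)).mulVec u = 0 ↔ ∀ j : Fin n, u j.castSucc = 0 := by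
  constructor
  · intro h j
    rw [← shift_mulVec u j, h, Pi.zero_apply]
  · intro h
    funext j
    refine Fin.cases (shift_mulVec_zero u) (fun j => ?_) j
    rw [shift_mulVec, h, Pi.zero_apply]

theorem finrank_ker_shift (n : ℕ) :
    Module.finrank k (LinearMap.ker (shift k (n + 1)).mulVecLin) = 1 := by
  refine finrank_eq_one ⟨Pi.single (Fin.last n) 1, ?_⟩ ?_ ?_
  · rw [LinearMap.mem_ker, Matrix.mulVecLin_apply, shift_ker]
    intro j
    exact Pi.single_eq_of_ne (Fin.castSucc_lt_last j).ne _
  · intro h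
    have := congrFun (congrArg Subtype.val h) (Fin.last n)
    simp at this
  · rintro ⟨u, hu⟩
    rw [LinearMap.mem_ker, Matrix.mulVecLin_apply, shift_ker] at hu
    refine ⟨u (Fin.last n), Subtype.ext (funext fun j => ?_)⟩
    refine Fin.lastCases ?_ (fun j => ?_) j
    · simp
    · simp [hu, (Fin.castSucc_lt_last j).ne]

/-- The matrix is lower unitriangular, so forward substitution kills the coordinates of a kernel
vector one after another. -/
theorem shift_add_one_injective (n : ℕ) :
    Function.Injective (shift k (n + 1) + 1).mulVecLin := by
  rw [← LinearMap.ker_eq_bot, LinearMap.ker_eq_bot']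
  intro u hu
  have hu' : ∀ j, (shift k (n + 1)).mulVec u j + u j = 0 := by
    intro j
    have h := congrFun hu j
    rwa [Matrix.mulVecLin_apply, Matrix.add_mulVec, Matrix.one_mulVec] at h
  funext j
  induction j using Fin.induction with
  | zero => simpa [shift_mulVec_zero] using hu' 0
  | succ j ih => simpa [shift_mulVec, ih] using hu' j.succ

/-- The coefficients of the quotient of `θ` by `X - μ`. -/
def horner (θ : Polynomial k) (n : ℕ) (μ : k) (j : ℕ) : k :=
  ∑ i ∈ Finset.range (j + 1), θ.coeff (n - i) * μ ^ (j - i)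

theorem horner_zero {θ : Polynomial k} (hθ : θ.Monic) (μ : k) :
    horner θ θ.natDegree μ 0 = 1 := by
  simp [horner, hθ.coeff_natDegree]

theorem horner_succ (θ : Polynomial k) (n : ℕ) (μ : k) (j : ℕ) :
    horner θ n μ (j + 1) = μ * horner θ n μ j + θ.coeff (n - (j + 1)) := by
  rw [horner, Finset.sum_range_succ, horner, Finset.mul_sum, Nat.sub_self, pow_zero, mul_one]
  congr 1
  refine Finset.sum_congr rfl fun i hi => ?_
  have hij : i ≤ j := Nat.lt_succ_iff.1 (Finset.mem_range.1 hi)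
  rw [Nat.succ_sub hij, pow_succ]
  ring

theorem horner_natDegree (θ : Polynomial k) (μ : k) :
    horner θ θ.natDegree μ θ.natDegree = θ.eval μ := by
  rw [horner, ← Finset.sum_range_reflect, Polynomial.eval_eq_sum_range]
  refine Finset.sum_congr rfl fun i hi => ?_
  have := Finset.mem_range.1 hi
  rw [show θ.natDegree + 1 - 1 - i = θ.natDegree - i by omega,
    show θ.natDegree - (θ.natDegree - i) = i by omega]

variable [CharP k 2]

/-- In characteristic `2`, the eigenvectors of the companion matrix are the multiples of the vector
of Horner coefficients. -/
theorem companion_eigenvector {n : ℕ} {θ : Polynomial k} (hθ : θ.Monic) (hn : θ.natDegree = n + 1)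
    (μ : k) (u : Fin (n + 1) → k) :
    (companion (n + 1) θ + μ • 1).mulVec u = 0 ↔
      (∀ j, u j = horner θ (n + 1) μ j * u 0) ∧ θ.eval μ * u 0 = 0 := by
  have hsucc : ∀ j : ℕ, horner θ (n + 1) μ (j + 1) = μ * horner θ (n + 1) μ j +
      θ.coeff (n - j) := by
    intro j
    rw [horner_succ, Nat.add_sub_add_right]
  have hzero : horner θ (n + 1) μ 0 = 1 := hn ▸ horner_zero hθ μ
  have htop : horner θ (n + 1) μ (n + 1) = θ.eval μ := hn ▸ horner_natDegree θ μ
  have key : (companion (n + 1) θ + μ • 1).mulVec u = 0 ↔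
      ∀ j : Fin (n + 1), θ.coeff (n - j) * u 0 +
        (if h : (j : ℕ) < n then u ⟨j + 1, by omega⟩ else 0) + μ * u j = 0 := by
    rw [funext_iff]
    refine forall_congr' fun j => ?_
    rw [← companion_mulVec, Matrix.add_mulVec, Matrix.smul_mulVec, Matrix.one_mulVec]
    rfl
  rw [key]
  constructor
  · intro h
    -- Since `-1 = 1`, each row but the last is the Horner recurrence, which determines `u` from `u
    -- 0`. The last row has no next coordinate and becomes the condition `θ(μ) u 0 = 0`.
    have hu : ∀ (j : ℕ) (hj : j < n + 1), u ⟨j, hj⟩ = horner θ (n + 1) μ j * u 0 := by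
      intro j
      induction j with
      | zero =>
        intro hj
        rw [hzero, one_mul]
        rfl
      | succ j ih =>
        intro hj
        have hj' := h ⟨j, by omega⟩
        rw [dif_pos (show j < n by omega), ih (by omega)] at hj'
        rw [hsucc]
        linear_combination hj' - (θ.coeff (n - j) * u 0 + μ * horner θ (n + 1) μ j * u 0) *
          CharTwo.two_eq_zero (R := k)
    refine ⟨fun j => hu j j.2, ?_⟩
    have hl := h (Fin.last n)
    rw [dif_neg (by simp), hu _ (Fin.last n).2, Fin.val_last] at hl
    rw [← htop, hsucc]
    linear_combination hl
  · rintro ⟨hu, h0⟩ j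
    rw [hu j]
    split_ifs with h
    · rw [hu ⟨j + 1, _⟩, hsucc]
      linear_combination (θ.coeff (n - j) * u 0 + μ * horner θ (n + 1) μ j * u 0) *
        CharTwo.two_eq_zero (R := k)
    · obtain rfl : j = Fin.last n := Fin.ext (by simp; omega)
      rw [← htop, hsucc] at h0
      rw [Fin.val_last]
      linear_combination h0

theorem companion_add_injective {n : ℕ} {θ : Polynomial k} (hθ : θ.Monic)
    (hn : θ.natDegree = n + 1) {μ : k} (hμ : θ.eval μ ≠ 0) :
    Function.Injective (companion (n + 1) θ + μ • 1).mulVecLin := by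
  rw [← LinearMap.ker_eq_bot, LinearMap.ker_eq_bot']
  intro u hu
  obtain ⟨h1, h2⟩ := (companion_eigenvector hθ hn μ u).1 hu
  funext j
  rw [h1, (mul_eq_zero.1 h2).resolve_left hμ, mul_zero, Pi.zero_apply]

theorem finrank_ker_companion_add {n : ℕ} {θ : Polynomial k} (hθ : θ.Monic)
    (hn : θ.natDegree = n + 1) {μ : k} (hμ : θ.eval μ = 0) :
    Module.finrank k
      (LinearMap.ker (companion (n + 1) θ + μ • 1).mulVecLin) = 1 := by
  have hzero : horner θ (n + 1) μ 0 = 1 := hn ▸ horner_zero hθ μ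
  refine finrank_eq_one ⟨fun j => horner θ (n + 1) μ j, ?_⟩ ?_ ?_
  · rw [LinearMap.mem_ker, Matrix.mulVecLin_apply, companion_eigenvector hθ hn]
    simp [hzero, hμ]
  · intro h
    have := congrFun (congrArg Subtype.val h) 0
    simp [hzero] at this
  · rintro ⟨u, hu⟩
    rw [LinearMap.mem_ker, Matrix.mulVecLin_apply, companion_eigenvector hθ hn] at hu
    refine ⟨u 0, Subtype.ext (funext fun j => ?_)⟩
    exact (mul_comm _ _).trans (hu.1 j).symm

end Matrices

/-! ### Powers of irreducible polynomials with a root -/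

section Polynomials

variable {k : Type u} [Field k]

/-- A root of `p ^ m` is a root of `p`, and a monic irreducible polynomial with a root `μ` is `X -
μ`. Taking `μ = 0` and `μ = 1` singles out the exceptional polynomials `X ^ n` and `(X + 1) ^ n`. -/
theorem eq_linear_pow_of_eval_eq_zero {θ p : Polynomial k} {m : ℕ} (hp : p.Monic)
    (hirr : Irreducible p) (hθ : θ = p ^ m) {μ : k} (hμ : θ.eval μ = 0) :
    θ = (Polynomial.X - Polynomial.C μ) ^ θ.natDegree := by
  rw [hθ, Polynomial.eval_pow] at hμ
  have h : Polynomial.X - Polynomial.C μ ∣ p :=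
    Polynomial.dvd_iff_isRoot.2 (eq_zero_of_pow_eq_zero hμ)
  have hpX : Polynomial.X - Polynomial.C μ = p :=
    Polynomial.eq_of_monic_of_associated (Polynomial.monic_X_sub_C μ) hp
      ((Polynomial.irreducible_X_sub_C μ).associated_of_dvd hirr h)
  rw [hθ, ← hpX, Polynomial.natDegree_pow, Polynomial.natDegree_X_sub_C, mul_one]

end Polynomials

/-! ### The modules `V_{2n,∞}` and `V_{2n,θ}` -/

section Klein

/-- The set `χ` is symmetric in the three involutions. This and the next lemma allow any of them to
serve as `s` in `rank_ext_of_pencil`. -/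
theorem kleinSubgroups_swap {G : Type u} [Group G] [IsKleinFour G] (σ τ : G) :
    kleinSubgroups τ σ = kleinSubgroups σ τ := by
  rw [kleinSubgroups, kleinSubgroups, klein_comm τ σ, Set.insert_comm]

theorem kleinSubgroups_mul_left {G : Type u} [Group G] [IsKleinFour G] (σ τ : G) :
    kleinSubgroups (σ * τ) τ = kleinSubgroups σ τ := by
  rw [kleinSubgroups, kleinSubgroups, mul_assoc, IsKleinFour.mul_self, mul_one]
  ext H
  simp only [Set.mem_insert_iff, Set.mem_singleton_iff]
  tauto

variable {k G : Type u} [Field k] [CharP k 2] [Group G] [IsKleinFour G] {σ τ : G}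
  {hσ : σ ≠ 1} {hτ : τ ≠ 1} {hστ : σ ≠ τ} {N : Rep.{u} k G} {n : ℕ}
  {A B : Matrix (Fin n) (Fin n) k}

theorem exists_pencil_of_iso (i : N ≅ kleinRep hσ hτ hστ A B) :
    ∃ e : N ≃ₗ[k] (Fin n → k) × (Fin n → k),
      (∀ x, e (N.ρ σ x) = ((e x).1, (e x).2 + A.mulVecLin (e x).1)) ∧
      (∀ x, e (N.ρ τ x) = ((e x).1, (e x).2 + B.mulVecLin (e x).1)) := by
  refine ⟨{ i.hom.hom.toLinearMap with
    invFun := i.inv.hom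
    left_inv := fun x => Rep.inv_hom_apply _ _ i x
    right_inv := fun x => Rep.hom_inv_apply _ _ i x }, fun x => ?_, fun x => ?_⟩
  · exact (Rep.hom_comm_apply i.hom σ x).trans (kleinRep_left hσ hτ hστ A B _ _)
  · exact (Rep.hom_comm_apply i.hom τ x).trans (kleinRep_right hσ hτ hστ A B _ _)

variable (P : RelProjResolution (kleinSubgroups σ τ) (Rep.trivial k G k))

/-- This lemma and the next two take `s = σ`, `s = τ` and `s = σ τ` respectively: `s` is the
involution whose matrix may be singular, and that matrix governs the positive degrees. -/
theorem rank_ext_of_iso_of_injective_right (i : N ≅ kleinRep hσ hτ hστ A B)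
    (hB : Function.Injective B.mulVecLin) (hAB : Function.Injective (A + B).mulVecLin) :
    Module.rank k (P.Ext N 0) = n ∧ ∀ i, Module.rank k (P.Ext N (i + 1)) =
      (n - Module.finrank k (LinearMap.ker A.mulVecLin) : ℕ) := by
  obtain ⟨e, h1, h2⟩ := exists_pencil_of_iso i
  rw [Matrix.mulVecLin_add] at hAB
  simpa using rank_ext_of_pencil hσ hτ hστ e _ _ h1 h2 hB hAB rfl P

theorem rank_ext_of_iso_of_injective_left (i : N ≅ kleinRep hσ hτ hστ A B)
    (hA : Function.Injective A.mulVecLin) (hAB : Function.Injective (B + A).mulVecLin) :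
    Module.rank k (P.Ext N 0) = n ∧ ∀ i, Module.rank k (P.Ext N (i + 1)) =
      (n - Module.finrank k (LinearMap.ker B.mulVecLin) : ℕ) := by
  obtain ⟨e, h1, h2⟩ := exists_pencil_of_iso i
  rw [Matrix.mulVecLin_add] at hAB
  simpa using rank_ext_of_pencil hτ hσ hστ.symm e _ _ h2 h1 hA hAB
    (kleinSubgroups_swap σ τ).symm P

theorem rank_ext_of_iso_of_injective (i : N ≅ kleinRep hσ hτ hστ A B)
    (hA : Function.Injective A.mulVecLin) (hB : Function.Injective B.mulVecLin) :
    Module.rank k (P.Ext N 0) = n ∧ ∀ i, Module.rank k (P.Ext N (i + 1)) =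
      (n - Module.finrank k (LinearMap.ker (A + B).mulVecLin) : ℕ) := by
  obtain ⟨e, h1, h2⟩ := exists_pencil_of_iso i
  have h3 : ∀ x, e (N.ρ (σ * τ) x) = ((e x).1, (e x).2 + (A + B).mulVecLin (e x).1) := by
    intro x
    rw [map_mul, Module.End.mul_apply, h1, h2, Matrix.mulVecLin_add, LinearMap.add_apply,
      add_assoc, add_comm (B.mulVecLin _)]
  have hBB : B + B = 0 := by
    ext i j
    exact CharTwo.add_self_eq_zero _
  -- With `s = σ τ` and `t = τ` the third involution `s t` is `σ`, acting through `(A + B) + B = A`.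
  have hAB : Function.Injective ((A + B).mulVecLin + B.mulVecLin) := by
    rwa [← Matrix.mulVecLin_add, add_assoc, hBB, add_zero]
  simpa using rank_ext_of_pencil (klein_mul_ne_one hστ) hτ (fun h => hσ (by simpa using h))
    e _ _ h3 h2 hB hAB (kleinSubgroups_mul_left σ τ).symm P

theorem rank_ext_VInfty (i : N ≅ VInfty hσ hτ hστ (n + 1)) :
    Module.rank k (P.Ext N 0) = (n + 1 : ℕ) ∧
      ∀ i, Module.rank k (P.Ext N (i + 1)) = (n : Cardinal) := by
  have h := rank_ext_of_iso_of_injective_left (A := 1) (B := shift k (n + 1)) P i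
    (one_mulVecLin_injective _) (shift_add_one_injective n)
  simpa only [finrank_ker_shift, Nat.add_sub_cancel] using h

variable {θ : Polynomial k}

/-- The case of `V_{2n,θ}` where `1` is not a root of `θ`. -/
theorem rank_ext_VTheta_of_eval_one_ne_zero (hθ : θ.Monic) (hn : θ.natDegree = n + 1)
    (h1 : θ.eval 1 ≠ 0) (i : N ≅ VTheta hσ hτ hστ (n + 1) θ) :
    Module.rank k (P.Ext N 0) = (n + 1 : ℕ) ∧ ∀ i, Module.rank k (P.Ext N (i + 1)) =
      (n + 1 - Module.finrank k (LinearMap.ker (companion (n + 1) θ).mulVecLin) : ℕ) := by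
  refine rank_ext_of_iso_of_injective_right (A := companion (n + 1) θ) (B := 1) P i
    (one_mulVecLin_injective _) ?_
  simpa only [one_smul] using companion_add_injective hθ hn h1

/-- The case of `V_{2n,θ}` where `0` is not a root of `θ`. -/
theorem rank_ext_VTheta_of_eval_zero_ne_zero (hθ : θ.Monic) (hn : θ.natDegree = n + 1)
    (h0 : θ.eval 0 ≠ 0) (i : N ≅ VTheta hσ hτ hστ (n + 1) θ) :
    Module.rank k (P.Ext N 0) = (n + 1 : ℕ) ∧ ∀ i, Module.rank k (P.Ext N (i + 1)) =
      (n + 1 - Module.finrank k (LinearMap.ker (companion (n + 1) θ + 1).mulVecLin) : ℕ) := by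
  refine rank_ext_of_iso_of_injective (A := companion (n + 1) θ) (B := 1) P i ?_
    (one_mulVecLin_injective _)
  simpa only [zero_smul, add_zero] using companion_add_injective hθ hn h0

theorem rank_ext_VTheta_X_pow (i : N ≅ VTheta hσ hτ hστ (n + 1) (Polynomial.X ^ (n + 1))) :
    Module.rank k (P.Ext N 0) = (n + 1 : ℕ) ∧
      ∀ i, Module.rank k (P.Ext N (i + 1)) = (n : Cardinal) := by
  have hθ : (Polynomial.X ^ (n + 1) : Polynomial k).Monic := Polynomial.monic_X_pow _
  have hn := Polynomial.natDegree_X_pow (R := k) (n + 1)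
  have h := rank_ext_VTheta_of_eval_one_ne_zero P hθ hn (by simp) i
  have hker := finrank_ker_companion_add hθ hn (μ := 0) (by simp)
  rw [zero_smul, add_zero] at hker
  simpa only [hker, Nat.add_sub_cancel] using h

theorem rank_ext_VTheta_X_add_one_pow
    (i : N ≅ VTheta hσ hτ hστ (n + 1) ((Polynomial.X + 1) ^ (n + 1))) :
    Module.rank k (P.Ext N 0) = (n + 1 : ℕ) ∧
      ∀ i, Module.rank k (P.Ext N (i + 1)) = (n : Cardinal) := by
  have hX : (Polynomial.X + 1 : Polynomial k).Monic := Polynomial.monic_X_add_C 1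
  have hn : ((Polynomial.X + 1) ^ (n + 1) : Polynomial k).natDegree = n + 1 := by
    rw [hX.natDegree_pow, ← Polynomial.C_1, Polynomial.natDegree_X_add_C, mul_one]
  have h := rank_ext_VTheta_of_eval_zero_ne_zero P (hX.pow _) hn (by simp) i
  have hker := finrank_ker_companion_add (hX.pow _) hn (μ := 1)
    (by simp [CharTwo.add_self_eq_zero])
  rw [one_smul] at hker
  simpa only [hker, Nat.add_sub_cancel] using h

theorem rank_ext_VTheta (hθ : θ.Monic) (hn : θ.natDegree = n + 1) (h0 : θ.eval 0 ≠ 0)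
    (h1 : θ.eval 1 ≠ 0) (i : N ≅ VTheta hσ hτ hστ (n + 1) θ) (j : ℕ) :
    Module.rank k (P.Ext N j) = (n + 1 : ℕ) := by
  have h := rank_ext_VTheta_of_eval_one_ne_zero P hθ hn h1 i
  have hker : LinearMap.ker (companion (n + 1) θ).mulVecLin = ⊥ := by
    rw [LinearMap.ker_eq_bot]
    simpa only [zero_smul, add_zero] using companion_add_injective hθ hn h0
  rw [hker, finrank_bot, Nat.sub_zero] at h
  cases j with
  | zero => exact h.1
  | succ j => exact h.2 j

end Klein

end RelCoh

theorem mainTheorem5 {k G : Type u} [Field k] [CharP k 2] [Group G] [IsKleinFour G]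
    (σ τ : G) (hσ : σ ≠ 1) (hτ : τ ≠ 1) (hστ : σ ≠ τ)
    (N : Rep.{u} k G) [Module.Finite k N] (hEven : Even (Module.finrank k N))
    (hIndec : Indecomposable N)
    (hNotProj : ¬ RelCoh.IsRelProjective (RelCoh.kleinSubgroups σ τ) N)
    (P : RelCoh.RelProjResolution (RelCoh.kleinSubgroups σ τ) (Rep.trivial k G k)) :
    (∀ n : ℕ, 1 ≤ n →
      (Nonempty (N ≅ RelCoh.VInfty hσ hτ hστ n) ∨
        Nonempty (N ≅ RelCoh.VTheta hσ hτ hστ n (Polynomial.X ^ n)) ∨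
        Nonempty (N ≅ RelCoh.VTheta hσ hτ hστ n ((Polynomial.X + 1) ^ n))) →
      Module.rank k (P.Ext N 0) = (n : Cardinal) ∧
        ∀ i : ℕ, 0 < i → Module.rank k (P.Ext N i) = ((n - 1 : ℕ) : Cardinal)) ∧
    (∀ (n : ℕ) (θ : Polynomial k), 1 ≤ n → θ.natDegree = n →
      (∃ (p : Polynomial k) (m : ℕ), p.Monic ∧ Irreducible p ∧ θ = p ^ m) →
      θ ≠ Polynomial.X ^ n → θ ≠ (Polynomial.X + 1) ^ n →
      Nonempty (N ≅ RelCoh.VTheta hσ hτ hστ n θ) →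
      ∀ i : ℕ, Module.rank k (P.Ext N i) = (n : Cardinal)) := by
  constructor
  · rintro n hn h
    -- From here `n + 1` is the size of the matrices, so the dimension in positive degrees is the
    -- new `n`.
    obtain ⟨n, rfl⟩ := Nat.exists_eq_add_of_le' hn
    have key : Module.rank k (P.Ext N 0) = (n + 1 : ℕ) ∧
        ∀ i, Module.rank k (P.Ext N (i + 1)) = (n : Cardinal) := by
      rcases h with ⟨⟨i⟩⟩ | ⟨⟨i⟩⟩ | ⟨⟨i⟩⟩
      · exact RelCoh.rank_ext_VInfty P i
      · exact RelCoh.rank_ext_VTheta_X_pow P i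
      · exact RelCoh.rank_ext_VTheta_X_add_one_pow P i
    refine ⟨key.1, fun i hi => ?_⟩
    obtain ⟨i, rfl⟩ := Nat.exists_eq_add_of_le' hi
    exact key.2 i
  · rintro n θ hn hdeg ⟨p, m, hp, hirr, hθ⟩ hX hX1 ⟨i⟩ j
    obtain ⟨n, rfl⟩ := Nat.exists_eq_add_of_le' hn
    refine RelCoh.rank_ext_VTheta P (hθ ▸ hp.pow m) hdeg (fun h => hX ?_) (fun h => hX1 ?_) i j
    · have := RelCoh.eq_linear_pow_of_eval_eq_zero hp hirr hθ h
      rwa [hdeg, Polynomial.C_0, sub_zero] at this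
    · have := RelCoh.eq_linear_pow_of_eval_eq_zero hp hirr hθ h
      rwa [hdeg, Polynomial.C_1, CharTwo.sub_eq_add] at this
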